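/- **Setting.** Let $\mathcal X$ be an input space, $\mathcal Y$ an output space, and $\ell:\mathcal Y\times\mathcal Y\to\mathbb R_+$ a bounded loss that is definite, i.e. $\ell(y,y')=0$ iff $y=y'$; put $M=\sup_{y,y'}\ell(y,y')$ and $\Phi^*(r)=\min(M,\max(0,r))$. For each input $x$ let $\mathcal Y(x)\subseteq\mathcal Y$ be the set of outputs allowed for $x$ (for instance $\mathcal Y(x)=\mathcal Y$). For each example $z=(x,y)$ the elements of $\mathcal Y(x)$ are identified (injectively) with elements of a finite product $\mathcal Y_1\times\dots\times\mathcal Y_l$ of finite label sets, and there is a factor graph $G(z)$ with variable nodes $\{1,\dots,l\}$, a finite set $F_z$ of factor nodes, and edges between variable and factor nodes; $l$, the label sets and the graph may depend on $z$. For $f\in F_z$ let $N(f)$ be the set of variable nodes joined to $f$, $\mathcal Y_f=\prod_{k\in N(f)}\mathcal Y_k$, and let $y'_f\in\mathcal Y_f$ be the restriction of $y'\in\mathcal Y(x)$ to $N(f)$. Let $\mathcal H$ be a nonempty family of scoring functions $h:\mathcal X\times\mathcal Y\to\mathbb R$ which, for every example $z=(x,y)$ with $y\in\mathcal Y(x)$,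 decompose as $h(x,y')=\sum_{f\in F_z}h_f(x,y'_f)$ for all $y'\in\mathcal Y(x)$. Let $\mathsf h(x)\in\operatorname{argmax}_{y\in\mathcal Y(x)}h(x,y)$ be the predictor of $h$, with any tie-breaking. Let $\mathcal D$ be a probability distribution on $\mathcal X\times\mathcal Y$ with $y\in\mathcal Y(x)$ almost surely, and $S=((x_1,y_1),\dots,(x_m,y_m))\sim\mathcal D^m$, $m\ge1$. All loss functions below, and the suprema over $\mathcal H$ of the relevant linear combinations of their values at the sample points and their expectations, are assumed measurable, and so is the empirical complexity below (for measurable functions, measurability of these suprema is automatic if $\mathcal H$ is countable). For $\rho>0$ define $R(h)=\mathbb E_{(x,y)\sim\mathcal D}[\ell(\mathsf h(x),y)]$, $$L^{\rm add}_{\rho,h}(x,y)=\Phi^*\Big(\max_{y'\neq y}\big\{\ell(y',y)-\tfrac1\rho[h(x,y)-h(x,y')]\big\}\Big),\qquad L^{\rm mult}_{\rho,h}(x,y)=\Phi^*\Big(\max_{y'\neq y}\ell(y',y)\big\{1-\tfrac1\rho[h(x,y)-h(x,y')]\big\}\Big),$$ where $y'$ ranges over $\mathcal Y(x)\setminus\{y\}$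 (the loss is $0$ if this set is empty), and for $\bullet\in\{\mathrm{add},\mathrm{mult}\}$ let $R^\bullet_\rho(h)=\mathbb E_{(x,y)\sim\mathcal D}[L^\bullet_{\rho,h}(x,y)]$ and $\widehat R^\bullet_{S,\rho}(h)=\frac1m\sum_{i=1}^mL^\bullet_{\rho,h}(x_i,y_i)$. The factor graph Rademacher complexity is $\mathfrak R^G_m(\mathcal H)=\mathbb E_{S\sim\mathcal D^m}[\widehat{\mathfrak R}^G_S(\mathcal H)]\in[0,\infty]$, where, with $F_i=F_{(x_i,y_i)}$ and independent uniform signs $\epsilon_{i,f,y}\in\{\pm1\}$, $$\widehat{\mathfrak R}^G_S(\mathcal H)=\frac1m\,\mathbb E_{\epsilon}\Big[\sup_{h\in\mathcal H}\sum_{i=1}^m\sum_{f\in F_i}\sum_{y\in\mathcal Y_f}\sqrt{|F_i|}\,\epsilon_{i,f,y}\,h_f(x_i,y)\Big].$$ **Theorem.** Fix $\rho>0$. For any $\delta>0$, with probability at least $1-\delta$ over the draw of $S$, for all $h\in\mathcal H$, $$R(h)\le R^{\rm add}_\rho(h)\le\widehat R^{\rm add}_{S,\rho}(h)+\frac{4\sqrt2}{\rho}\,\mathfrak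 R^G_m(\mathcal H)+M\sqrt{\frac{\log\frac1\delta}{2m}}.$$ Likewise, for any $\delta>0$, with probability at least $1-\delta$ over the draw of $S$, for all $h\in\mathcal H$, $$R(h)\le R^{\rm mult}_\rho(h)\le\widehat R^{\rm mult}_{S,\rho}(h)+\frac{4\sqrt2\,M}{\rho}\,\mathfrak R^G_m(\mathcal H)+M\sqrt{\frac{\log\frac1\delta}{2m}}.$$ (When $\delta>1$ the claims are void, and the square root is read as $0$. In the second bound, $0\cdot\infty=0$.) -/

import Mathlib

open MeasureTheory

namespace StructPred

/-- A factor graph whose variable nodes are the substructure indices `1, …, l`: a finite set of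
factor nodes and a set of edges, each joining a variable node and a factor node. -/
structure FactorGraph (l : ℕ) where
  Factor : Type
  [fintypeFactor : Fintype Factor]
  edges : Set (Fin l × Factor)

attribute [instance] FactorGraph.fintypeFactor

/-- The neighborhood `N(f)`: the variable nodes joined to the factor node `f`. -/
def FactorGraph.nbhd {l : ℕ} (G : FactorGraph l) (f : G.Factor) : Set (Fin l) :=
  {k | (k, f) ∈ G.edges}

/-- The output structure over inputs `X` and outputs `Y`. The outputs allowed for the input `x` form
the set `out x`. For each example `z = (x, y)` they are decomposed into `len z` substructures, the
`k`-th one being labelled by an element of the finite set `Label z k`, and there is a factor graph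
`graph z` on these substructures. When `Y` is a fixed finite product `Y₁ × ⋯ × Y_l`, one takes
`out x` to be all of `Y` and `coords` to be the identity. -/
structure OutputModel (X Y : Type*) where
  out : X → Set Y
  len : X × Y → ℕ
  Label : (z : X × Y) → Fin (len z) → Type
  [fintypeLabel : ∀ z k, Fintype (Label z k)]
  coords : (z : X × Y) → out z.1 ↪ ((k : Fin (len z)) → Label z k)
  graph : (z : X × Y) → FactorGraph (len z)

attribute [instance] OutputModel.fintypeLabel

section

variable {X Y : Type*} (O : OutputModel X Y)

/-- The factor nodes of the graph of the example `z`. -/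
abbrev OutputModel.Factor (z : X × Y) : Type := (O.graph z).Factor

/-- The product `Y_f` of the label sets of the substructures joined to the factor node `f`. -/
abbrev OutputModel.LocalOutput (z : X × Y) (f : O.Factor z) : Type :=
  (k : (O.graph z).nbhd f) → O.Label z k

/-- The restriction `y_f` of an output to the substructures joined to `f`. -/
def OutputModel.restrict (z : X × Y) (f : O.Factor z) (y : O.out z.1) : O.LocalOutput z f :=
  fun k => O.coords z y k

open Classical in
noncomputable instance (z : X × Y) (f : O.Factor z) : Fintype (O.LocalOutput z f) :=
  inferInstance

/-- A family of scoring functions `score h : X × Y → ℝ`, indexed by `h : H`, each written as a sum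
over the factor nodes of local functions: `localScore h (x, y) f` is the function `h_f(x, ·)` on `Y_f`,
where `f` is a factor node of the graph of the example `(x, y)`. -/
structure ScoringFamily (H : Type*) where
  score : H → X → Y → ℝ
  localScore : H → (z : X × Y) → (f : O.Factor z) → O.LocalOutput z f → ℝ
  score_eq : ∀ (h : H) (z : X × Y), z.2 ∈ O.out z.1 → ∀ y : O.out z.1,
    score h z.1 y = ∑ f : O.Factor z, localScore h z f (O.restrict z f y)

/-- The indices `(i, f, y)` of the Rademacher variables: `i ≤ m`, `f ∈ F_i`, `y ∈ Y_f`. -/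
abbrev OutputModel.SignIndex {m : ℕ} (S : Fin m → X × Y) : Type :=
  (i : Fin m) × (f : O.Factor (S i)) × O.LocalOutput (S i) f

variable {O} {H : Type*} (F : ScoringFamily O H)

/-- `∑ᵢ ∑_{f ∈ F_i} ∑_{y ∈ Y_f} √|F_i| ε_{i,f,y} h_f(x_i, y)`. -/
noncomputable def ScoringFamily.signedSum {m : ℕ} (S : Fin m → X × Y)
    (ε : O.SignIndex S → ℤˣ) (h : H) : ℝ :=
  ∑ i : Fin m, ∑ f : O.Factor (S i), ∑ y : O.LocalOutput (S i) f,
    Real.sqrt (Fintype.card (O.Factor (S i))) * ((ε ⟨i, f, y⟩ : ℤ) : ℝ) * F.localScore h (S i) f y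

open Classical in
/-- The empirical factor graph Rademacher complexity. The expectation over independent uniform
signs is the average over all sign patterns; the supremum is taken in the extended reals. -/
noncomputable def ScoringFamily.empRademacher {m : ℕ} (S : Fin m → X × Y) : EReal :=
  (((m : ℝ)⁻¹ * ((Fintype.card (O.SignIndex S → ℤˣ) : ℝ))⁻¹ : ℝ) : EReal) *
    ∑ ε : O.SignIndex S → ℤˣ, ⨆ h : H, ((F.signedSum S ε h : ℝ) : EReal)

/-- The factor graph Rademacher complexity: the expectation of the empirical one (which is
nonnegative when `H` is nonempty) over samples of size `m`; it may be infinite. -/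
noncomputable def ScoringFamily.rademacher [MeasurableSpace X] [MeasurableSpace Y]
    (D : Measure (X × Y)) (m : ℕ) : ENNReal :=
  ∫⁻ S : Fin m → X × Y, (F.empRademacher S).toENNReal ∂(Measure.pi fun _ => D)

/-- `M`, the largest value (the supremum) of the loss. -/
noncomputable def maxLoss (loss : Y → Y → ℝ) : ℝ :=
  sSup (Set.range fun p : Y × Y => loss p.1 p.2)

/-- Truncation of `r` to the interval `[0, M]`. -/
noncomputable def clip (M r : ℝ) : ℝ := min M (max 0 r)

/-- The additive margin loss at an example. The maximum is over the finitely many other outputs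
allowed for the input; if there is none, the margin loss is `0`. -/
noncomputable def ScoringFamily.addLoss (loss : Y → Y → ℝ) (ρ : ℝ) (h : H) (z : X × Y) : ℝ :=
  clip (maxLoss loss) (⨆ y : {y : Y // y ∈ O.out z.1 ∧ y ≠ z.2},
    (loss y z.2 - (1 / ρ) * (F.score h z.1 z.2 - F.score h z.1 y)))

/-- The multiplicative margin loss at an example, with the same convention. -/
noncomputable def ScoringFamily.multLoss (loss : Y → Y → ℝ) (ρ : ℝ) (h : H) (z : X × Y) : ℝ :=
  clip (maxLoss loss) (⨆ y : {y : Y // y ∈ O.out z.1 ∧ y ≠ z.2},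
    (loss y z.2 * (1 - (1 / ρ) * (F.score h z.1 z.2 - F.score h z.1 y))))

/-- `pred h` is a predictor of `h`: it maps `x` to a maximizer of `h(x, ·)` over the allowed
outputs, with any rule for breaking ties. -/
def ScoringFamily.IsPredictor (pred : H → X → Y) : Prop :=
  ∀ h x, pred h x ∈ O.out x ∧ ∀ y ∈ O.out x, F.score h x y ≤ F.score h x (pred h x)

end

section

variable {Z H : Type*}

/-- The average of `L` over the sample `S`. -/
noncomputable def empMean {m : ℕ} (S : Fin m → Z) (L : Z → ℝ) : ℝ :=
  (1 / (m : ℝ)) * ∑ i : Fin m, L (S i)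

/-- Measurability of a class of loss functions (automatic, for measurable functions, when `H` is
countable): each of them is measurable, and so are the suprema over the class of linear combinations
of the expected loss and of the losses at the `m` sample points. -/
def MeasurableClass [MeasurableSpace Z] (D : Measure Z) (m : ℕ) (L : H → Z → ℝ) : Prop :=
  (∀ h, AEMeasurable (L h) D) ∧
    ∀ (c : ℝ) (a : Fin m → ℝ),
      AEMeasurable (fun S : Fin m → Z => ⨆ h : H, (c * ∫ z, L h z ∂D + ∑ i, a i * L h (S i)))
        (Measure.pi fun _ => D)

end

end StructPred

/-! The predictor maximizes the score, so its margin against the true output is nonpositive. Hence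
its loss is either zero or dominated by its own term in the margin maximum (`loss_pred_le_clip`),
and truncation at `M` cuts nothing off. This gives the left inequality.

The right inequality is a uniform deviation bound for losses in `[0, M]`. The worst gap between
expectation and empirical mean has bounded differences, so McDiarmid concentrates it around its
mean, and a ghost sample bounds that mean by twice a Rademacher average of the losses.

It remains to pass from losses to local scores. By Cauchy–Schwarz over the factors, each loss is
Lipschitz in the vector of all local scores at the example, for the Euclidean distance scaled by
`√|F|`. The vector contraction inequality replaces one sign per example by one sign per local score,
at the price of a factor `√2`. This is exactly the constant of the sharp Khintchine inequality,
proved here by Fourier analysis: an even function on the cube has no first-level Walsh coefficients,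
which doubles its Poincaré constant.

The constant `4√2/ρ` is `2` (symmetrization) times `√2` (contraction) times `2/ρ` (two scores in a
margin); the multiplicative loss brings a further `M`. -/

open scoped BigOperators

namespace StructPred

set_option linter.unusedSectionVars false

/-! ### Fourier analysis on the discrete cube and the sharp Khintchine inequality. -/

section Signs

variable {ι : Type*} [Fintype ι] [DecidableEq ι]

/-- The real value of a sign. -/
def signVal (s : ℤˣ) : ℝ := ((s : ℤ) : ℝ)

@[simp] lemma signVal_one : signVal 1 = 1 := by simp [signVal]

@[simp] lemma signVal_neg (s : ℤˣ) : signVal (-s) = -signVal s := by simp [signVal]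

@[simp] lemma signVal_mul_self (s : ℤˣ) : signVal s * signVal s = 1 := by
  rcases Int.units_eq_one_or s with rfl | rfl <;> simp

/-- The sign pattern obtained by flipping the `i`-th sign. -/
def flipSign (i : ι) (ε : ι → ℤˣ) : ι → ℤˣ := Function.update ε i (-ε i)

lemma flipSign_flipSign (i : ι) (ε : ι → ℤˣ) : flipSign i (flipSign i ε) = ε := by
  simp [flipSign]

lemma expect_flipSign (i : ι) (f : (ι → ℤˣ) → ℝ) : 𝔼 ε, f (flipSign i ε) = 𝔼 ε, f ε :=
  Fintype.expect_bijective (flipSign i)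
    (Function.Involutive.bijective (flipSign_flipSign i)) _ _ fun _ => rfl

lemma expect_neg_signs (f : (ι → ℤˣ) → ℝ) : 𝔼 ε, f (-ε) = 𝔼 ε, f ε :=
  Fintype.expect_bijective (fun ε => -ε) (Function.Involutive.bijective neg_neg) _ _ fun _ => rfl

/-- The Walsh function of a set of coordinates. -/
def walsh (A : Finset ι) (ε : ι → ℤˣ) : ℝ := ∏ i ∈ A, signVal (ε i)

/-- The Walsh coefficient of a function on the discrete cube. -/
noncomputable def walshCoeff (f : (ι → ℤˣ) → ℝ) (A : Finset ι) : ℝ := 𝔼 ε, f ε * walsh A ε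

/-- The sum is the expansion of `∏ (1 + ε i * ε' i)`, in which one differing coordinate produces a
zero factor. -/
lemma sum_walsh_mul_walsh (ε ε' : ι → ℤˣ) :
    ∑ A : Finset ι, walsh A ε * walsh A ε' =
      if ε = ε' then (Fintype.card (ι → ℤˣ) : ℝ) else 0 := by
  have h : ∑ A : Finset ι, walsh A ε * walsh A ε' =
      ∏ i : ι, (1 + signVal (ε i) * signVal (ε' i)) := by
    rw [Finset.prod_one_add, Finset.powerset_univ]
    exact Finset.sum_congr rfl fun A _ => by rw [walsh, walsh, Finset.prod_mul_distrib]
  rw [h]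
  split_ifs with he
  · subst he
    simp only [signVal_mul_self]
    norm_num
  · obtain ⟨i, hi⟩ := Function.ne_iff.1 he
    refine Finset.prod_eq_zero (Finset.mem_univ i) ?_
    have : ε' i = -ε i := by
      rcases Int.units_eq_one_or (ε i) with h1 | h1 <;>
        rcases Int.units_eq_one_or (ε' i) with h2 | h2 <;> simp_all
    rw [this, signVal_neg, mul_neg, signVal_mul_self, add_neg_cancel]

/-- Parseval, from the completeness relation `sum_walsh_mul_walsh`. -/
lemma sum_sq_walshCoeff (f : (ι → ℤˣ) → ℝ) :
    ∑ A : Finset ι, walshCoeff f A ^ 2 = 𝔼 ε, f ε ^ 2 := by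
  have h : ∀ A : Finset ι, walshCoeff f A ^ 2 =
      𝔼 ε, 𝔼 ε', f ε * f ε' * (walsh A ε * walsh A ε') := by
    intro A
    rw [sq, walshCoeff, Finset.expect_mul_expect]
    exact Finset.expect_congr rfl fun ε _ => Finset.expect_congr rfl fun ε' _ => by ring
  simp_rw [h]
  rw [← Finset.expect_sum_comm]
  refine Finset.expect_congr rfl fun ε _ => ?_
  rw [← Finset.expect_sum_comm]
  simp_rw [← Finset.mul_sum, sum_walsh_mul_walsh]
  rw [Fintype.expect_eq_sum_div_card]
  simp only [mul_ite, mul_zero, Finset.sum_ite_eq, Finset.mem_univ, if_true]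
  field_simp

lemma walsh_flipSign (i : ι) (A : Finset ι) (ε : ι → ℤˣ) :
    walsh A (flipSign i ε) = (if i ∈ A then -1 else 1) * walsh A ε := by
  unfold walsh
  split_ifs with h
  · rw [← Finset.mul_prod_erase _ _ h, ← Finset.mul_prod_erase _ (fun i => signVal (ε i)) h]
    have : ∏ x ∈ A.erase i, signVal (flipSign i ε x) = ∏ x ∈ A.erase i, signVal (ε x) :=
      Finset.prod_congr rfl fun x hx => by
        simp [flipSign, Function.update_of_ne (Finset.ne_of_mem_erase hx)]
    rw [this]
    simp [flipSign]
  · rw [one_mul]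
    refine Finset.prod_congr rfl fun x hx => ?_
    have : x ≠ i := fun hh => h (hh ▸ hx)
    simp [flipSign, Function.update_of_ne this]

/-- Flips act diagonally on the Walsh basis, so `f - f ∘ flipSign i` keeps, doubled, only the
coefficients of the sets containing `i`. -/
lemma walshCoeff_flipSign (i : ι) (f : (ι → ℤˣ) → ℝ) (A : Finset ι) :
    walshCoeff (fun ε => f (flipSign i ε)) A = (if i ∈ A then -1 else 1) * walshCoeff f A := by
  unfold walshCoeff
  rw [← expect_flipSign i, Finset.mul_expect]
  refine Finset.expect_congr rfl fun ε _ => ?_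
  simp only [flipSign_flipSign, walsh_flipSign]
  ring

lemma walshCoeff_sub (f g : (ι → ℤˣ) → ℝ) (A : Finset ι) :
    walshCoeff (fun ε => f ε - g ε) A = walshCoeff f A - walshCoeff g A := by
  unfold walshCoeff
  rw [← Finset.expect_sub_distrib]
  exact Finset.expect_congr rfl fun ε _ => by ring

lemma walsh_neg (A : Finset ι) (ε : ι → ℤˣ) : walsh A (-ε) = (-1) ^ A.card * walsh A ε := by
  simp [walsh, Finset.prod_neg]

lemma walshCoeff_eq_zero_of_even {f : (ι → ℤˣ) → ℝ} (hf : ∀ ε, f (-ε) = f ε) {A : Finset ι}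
    (hA : Odd A.card) : walshCoeff f A = 0 := by
  have h : walshCoeff f A = -walshCoeff f A := by
    conv_lhs => rw [walshCoeff, ← expect_neg_signs]
    rw [walshCoeff, ← Finset.expect_neg_distrib]
    refine Finset.expect_congr rfl fun ε _ => ?_
    rw [hf, walsh_neg, hA.neg_one_pow]
    ring
  linarith

/-- The Poincaré inequality on the discrete cube for even functions. -/
lemma poincare_of_even {f : (ι → ℤˣ) → ℝ} (hf : ∀ ε, f (-ε) = f ε) :
    8 * (𝔼 ε, f ε ^ 2 - (𝔼 ε, f ε) ^ 2) ≤ ∑ i, 𝔼 ε, (f ε - f (flipSign i ε)) ^ 2 := by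
  have h1 : ∑ i, 𝔼 ε, (f ε - f (flipSign i ε)) ^ 2 =
      ∑ A : Finset ι, 4 * A.card * walshCoeff f A ^ 2 := by
    simp_rw [← sum_sq_walshCoeff, walshCoeff_sub, walshCoeff_flipSign]
    rw [Finset.sum_comm]
    refine Finset.sum_congr rfl fun A _ => ?_
    have : ∀ i, (walshCoeff f A - (if i ∈ A then -1 else 1) * walshCoeff f A) ^ 2 =
        if i ∈ A then 4 * walshCoeff f A ^ 2 else 0 := by
      intro i; split_ifs <;> ring
    simp_rw [this]
    simp
    ring
  have h2 : 𝔼 ε, f ε = walshCoeff f ∅ := by simp [walshCoeff, walsh]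
  rw [h1, h2, ← sum_sq_walshCoeff, ← Finset.add_sum_erase _ _ (Finset.mem_univ (∅ : Finset ι)),
    add_sub_cancel_left, Finset.mul_sum, ← Finset.add_sum_erase Finset.univ
      (fun A => 4 * (A.card : ℝ) * walshCoeff f A ^ 2) (Finset.mem_univ (∅ : Finset ι))]
  simp only [Finset.card_empty, Nat.cast_zero, mul_zero, zero_mul, zero_add]
  refine Finset.sum_le_sum fun A hA => ?_
  have hA' : A.card ≠ 0 := by simpa using Finset.ne_of_mem_erase hA
  -- The gain from `4` to `8`: a nonempty set of even size has at least two elements, and odd levels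
  -- contribute nothing.
  rcases Nat.even_or_odd A.card with h | h
  · have : 2 ≤ A.card := by
      obtain ⟨k, hk⟩ := h
      omega
    have : (2 : ℝ) ≤ A.card := by exact_mod_cast this
    gcongr
    linarith
  · simp [walshCoeff_eq_zero_of_even hf h]

/-- The Rademacher sum with coefficients `v`. -/
def radSum (v : ι → ℝ) (ε : ι → ℤˣ) : ℝ := ∑ i, signVal (ε i) * v i

lemma radSum_flipSign (v : ι → ℝ) (i : ι) (ε : ι → ℤˣ) :
    radSum v (flipSign i ε) = radSum v ε - 2 * (signVal (ε i) * v i) := by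
  unfold radSum
  rw [← Finset.add_sum_erase _ _ (Finset.mem_univ i), ← Finset.add_sum_erase _
    (fun i => signVal (ε i) * v i) (Finset.mem_univ i)]
  have : ∑ x ∈ Finset.univ.erase i, signVal (flipSign i ε x) * v x =
      ∑ x ∈ Finset.univ.erase i, signVal (ε x) * v x :=
    Finset.sum_congr rfl fun x hx => by
      simp [flipSign, Function.update_of_ne (Finset.ne_of_mem_erase hx)]
  rw [this]
  simp [flipSign]
  ring

lemma radSum_neg (v : ι → ℝ) (ε : ι → ℤˣ) : radSum v (-ε) = -radSum v ε := by
  simp [radSum]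

lemma expect_sq_radSum (v : ι → ℝ) : 𝔼 ε, radSum v ε ^ 2 = ∑ i, v i ^ 2 := by
  have h : ∀ i j, 𝔼 ε : ι → ℤˣ, signVal (ε i) * signVal (ε j) = if i = j then 1 else 0 := by
    intro i j
    split_ifs with hij
    · subst hij
      simp
    · have := expect_flipSign i fun ε : ι → ℤˣ => signVal (ε i) * signVal (ε j)
      simp only [flipSign, Function.update_self, Function.update_of_ne (Ne.symm hij), signVal_neg,
        neg_mul, Finset.expect_neg_distrib] at this
      linarith
  have h2 : ∀ ε, radSum v ε ^ 2 =
      ∑ i, ∑ j, signVal (ε i) * signVal (ε j) * (v i * v j) := by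
    intro ε
    rw [sq, radSum, Finset.sum_mul_sum]
    exact Finset.sum_congr rfl fun i _ => Finset.sum_congr rfl fun j _ => by ring
  simp_rw [h2, Finset.expect_sum_comm, ← Finset.expect_mul, h]
  simp [sq]

/-- The Khintchine inequality between the first and second moments, with the optimal constant. -/
theorem khintchine (v : ι → ℝ) :
    Real.sqrt (∑ i, v i ^ 2) ≤ Real.sqrt 2 * 𝔼 ε, |radSum v ε| := by
  set f : (ι → ℤˣ) → ℝ := fun ε => |radSum v ε| with hf
  have heven : ∀ ε, f (-ε) = f ε := fun ε => by simp [hf, radSum_neg]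
  have hsq : 𝔼 ε, f ε ^ 2 = ∑ i, v i ^ 2 := by simp [hf, expect_sq_radSum]
  -- Each term of the Rademacher sum is negated by exactly one of the `n` flips, so the flipped sums
  -- add up to `n - 2` times the original.
  have hflip : ∀ ε, ((Fintype.card ι : ℝ) - 2) * f ε ≤ ∑ i, f (flipSign i ε) := by
    intro ε
    have : ∑ i, radSum v (flipSign i ε) = ((Fintype.card ι : ℝ) - 2) * radSum v ε := by
      simp_rw [radSum_flipSign, Finset.sum_sub_distrib, ← Finset.mul_sum]
      simp [radSum]
      ring
    calc ((Fintype.card ι : ℝ) - 2) * f ε ≤ |(Fintype.card ι : ℝ) - 2| * f ε :=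
          mul_le_mul_of_nonneg_right (le_abs_self _) (abs_nonneg _)
      _ = |∑ i, radSum v (flipSign i ε)| := by rw [this, abs_mul]
      _ ≤ _ := Finset.abs_sum_le_sum_abs (fun i => radSum v (flipSign i ε)) Finset.univ
  have henergy : ∑ i, 𝔼 ε, (f ε - f (flipSign i ε)) ^ 2 ≤ 4 * 𝔼 ε, f ε ^ 2 := by
    have h1 : ∀ i, 𝔼 ε, (f ε - f (flipSign i ε)) ^ 2 =
        𝔼 ε, (2 * f ε ^ 2 - 2 * f ε * f (flipSign i ε)) := by
      intro i
      have h2 : ∀ ε, (f ε - f (flipSign i ε)) ^ 2 =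
          (f ε ^ 2 - 2 * f ε * f (flipSign i ε)) + f (flipSign i ε) ^ 2 := fun ε => by ring
      simp_rw [h2]
      rw [Finset.expect_add_distrib, expect_flipSign i (fun ε => f ε ^ 2),
        ← Finset.expect_add_distrib]
      exact Finset.expect_congr rfl fun ε _ => by ring
    simp_rw [h1]
    rw [← Finset.expect_sum_comm, Finset.mul_expect]
    refine Finset.expect_le_expect fun ε _ => ?_
    simp_rw [Finset.sum_sub_distrib, mul_assoc, ← Finset.mul_sum]
    simp only [Finset.sum_const, Finset.card_univ, nsmul_eq_mul]
    have := mul_le_mul_of_nonneg_left (hflip ε) (show 0 ≤ 2 * f ε by simp [hf])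
    linarith
  -- With `henergy` this reads `8 (E f² - (E f)²) ≤ 4 E f²`, that is `E f² ≤ 2 (E f)²`. The general
  -- Poincaré constant `4` would yield nothing.
  have hp := poincare_of_even heven
  have hnn : 0 ≤ 𝔼 ε, f ε := Finset.expect_nonneg fun ε _ => abs_nonneg _
  rw [← hsq]
  refine Real.sqrt_le_iff.2 ⟨by positivity, ?_⟩
  rw [mul_pow, Real.sq_sqrt (by norm_num)]
  linarith

end Signs

/-! ### Vector contraction for Rademacher averages. -/

section Contraction

lemma expect_sign (f : ℤˣ → ℝ) : 𝔼 s, f s = (f 1 + f (-1)) / 2 := by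
  rw [Fintype.expect_eq_sum_div_card, UnitsInt.univ]
  simp

lemma expect_prod {α β : Type*} [Fintype α] [Fintype β] (f : α × β → ℝ) :
    𝔼 p, f p = 𝔼 a, 𝔼 b, f (a, b) := by
  rw [← Finset.univ_product_univ, Finset.expect_product]

variable {H : Type*} [Finite H] [Nonempty H]

/-- Maximizers for the two values of the sign turn the left side into a difference `ψ h₁ - ψ h₂`.
The Lipschitz bound and Khintchine dominate it by a mean absolute Rademacher sum, which the suprema
at `ε` and `-ε` absorb. -/
lemma expect_iSup_sign_le {J : Type*} [Fintype J] [DecidableEq J] (ψ : H → ℝ) (v : H → J → ℝ)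
    (hψ : ∀ h h', |ψ h - ψ h'| ≤ Real.sqrt (∑ j, (v h j - v h' j) ^ 2)) (g : H → ℝ) :
    𝔼 s : ℤˣ, ⨆ h, (signVal s * ψ h + g h) ≤
      𝔼 ε : J → ℤˣ, ⨆ h, (Real.sqrt 2 * radSum (v h) ε + g h) := by
  set A : (J → ℤˣ) → ℝ := fun ε => ⨆ h, (Real.sqrt 2 * radSum (v h) ε + g h)
  have hA : ∀ ε h, Real.sqrt 2 * radSum (v h) ε + g h ≤ A ε := fun ε h =>
    le_ciSup (f := fun h => Real.sqrt 2 * radSum (v h) ε + g h) (Set.finite_range _).bddAbove h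
  obtain ⟨h₁, hh₁⟩ := exists_eq_ciSup_of_finite (f := fun h => signVal 1 * ψ h + g h)
  obtain ⟨h₂, hh₂⟩ := exists_eq_ciSup_of_finite (f := fun h => signVal (-1) * ψ h + g h)
  have hsub : ∀ ε, radSum (fun j => v h₁ j - v h₂ j) ε = radSum (v h₁) ε - radSum (v h₂) ε := by
    intro ε
    simp [radSum, mul_sub]
  calc 𝔼 s : ℤˣ, ⨆ h, (signVal s * ψ h + g h)
      = (ψ h₁ - ψ h₂ + (g h₁ + g h₂)) / 2 := by
        rw [expect_sign, ← hh₁, ← hh₂]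
        simp
        ring
    _ ≤ (Real.sqrt 2 * 𝔼 ε, |radSum (fun j => v h₁ j - v h₂ j) ε| + (g h₁ + g h₂)) / 2 := by
        have := (le_abs_self _).trans ((hψ h₁ h₂).trans (khintchine _))
        linarith
    _ = 𝔼 ε, (Real.sqrt 2 * |radSum (v h₁) ε - radSum (v h₂) ε| + (g h₁ + g h₂)) / 2 := by
        rw [← Finset.expect_div, Finset.expect_add_distrib, Finset.mul_expect,
          Fintype.expect_const]
        simp_rw [hsub]
    -- Testing `A ε` at one of `h₁`, `h₂` and `A (-ε)` at the other realizes either sign of the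
    -- absolute value.
    _ ≤ 𝔼 ε, (A ε + A (-ε)) / 2 := by
        refine Finset.expect_le_expect fun ε _ => ?_
        have h1 := hA ε h₁
        have h2 := hA ε h₂
        have h3 := hA (-ε) h₁
        have h4 := hA (-ε) h₂
        rw [radSum_neg] at h3 h4
        rcases abs_cases (radSum (v h₁) ε - radSum (v h₂) ε) with ⟨h, _⟩ | ⟨h, _⟩ <;> rw [h] <;>
          linarith
    _ = 𝔼 ε, A ε := by
        rw [← Finset.expect_div, Finset.expect_add_distrib, expect_neg_signs]
        ring

/-- The vector contraction inequality for Rademacher averages over a finite class. -/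
theorem expect_iSup_le_of_lipschitz (m : ℕ) (J : Fin m → Type) [∀ i, Fintype (J i)]
    [∀ i, DecidableEq (J i)] (ψ : (i : Fin m) → H → ℝ) (v : (i : Fin m) → H → J i → ℝ)
    (hψ : ∀ i h h', |ψ i h - ψ i h'| ≤ Real.sqrt (∑ j, (v i h j - v i h' j) ^ 2)) (g : H → ℝ) :
    𝔼 σ : Fin m → ℤˣ, ⨆ h, (∑ i, signVal (σ i) * ψ i h + g h) ≤
      𝔼 ε : (i : Fin m) → J i → ℤˣ, ⨆ h, (Real.sqrt 2 * ∑ i, radSum (v i h) (ε i) + g h) := by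
  -- The free term `g` holds the coordinates not being replaced at the current stage.
  induction m generalizing g with
  | zero => simp
  | succ m ih =>
    calc 𝔼 σ : Fin (m + 1) → ℤˣ, ⨆ h, (∑ i, signVal (σ i) * ψ i h + g h)
        = 𝔼 s : ℤˣ, 𝔼 σ : Fin m → ℤˣ,
            ⨆ h, (∑ i, signVal (σ i) * ψ i.succ h + (signVal s * ψ 0 h + g h)) := by
          rw [← expect_prod (fun p : ℤˣ × (Fin m → ℤˣ) =>
            ⨆ h, (∑ i, signVal (p.2 i) * ψ i.succ h + (signVal p.1 * ψ 0 h + g h)))]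
          refine Fintype.expect_equiv (Fin.consEquiv fun _ => ℤˣ).symm _ _ fun σ => ?_
          refine iSup_congr fun h => ?_
          rw [Fin.sum_univ_succ]
          simp [Fin.tail, Fin.consEquiv]
          ring
      _ ≤ 𝔼 s : ℤˣ, 𝔼 ε : (i : Fin m) → J i.succ → ℤˣ, ⨆ h, (Real.sqrt 2 *
            ∑ i : Fin m, radSum (v i.succ h) (ε i) + (signVal s * ψ 0 h + g h)) :=
          Finset.expect_le_expect fun s _ =>
            ih (fun i => J i.succ) (fun i => ψ i.succ) (fun i => v i.succ) (fun i => hψ i.succ) _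
      _ = 𝔼 ε : (i : Fin m) → J i.succ → ℤˣ, 𝔼 s : ℤˣ, ⨆ h, (signVal s * ψ 0 h +
            (Real.sqrt 2 * ∑ i : Fin m, radSum (v i.succ h) (ε i) + g h)) := by
          rw [Finset.expect_comm]
          refine Finset.expect_congr rfl fun ε _ => Finset.expect_congr rfl fun s _ =>
            iSup_congr fun h => by ring
      _ ≤ 𝔼 ε : (i : Fin m) → J i.succ → ℤˣ, 𝔼 ε₀ : J 0 → ℤˣ,
            ⨆ h, (Real.sqrt 2 * radSum (v 0 h) ε₀ +
              (Real.sqrt 2 * ∑ i : Fin m, radSum (v i.succ h) (ε i) + g h)) :=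
          Finset.expect_le_expect fun ε _ => expect_iSup_sign_le _ _ (hψ 0) _
      _ = _ := by
          rw [Finset.expect_comm, ← expect_prod (fun p : (J 0 → ℤˣ) ×
            ((i : Fin m) → J i.succ → ℤˣ) => ⨆ h, (Real.sqrt 2 * radSum (v 0 h) p.1 +
              (Real.sqrt 2 * ∑ i : Fin m, radSum (v i.succ h) (p.2 i) + g h)))]
          refine Fintype.expect_equiv (Fin.consEquiv fun i => J i → ℤˣ) _ _ fun ε => ?_
          refine iSup_congr fun h => ?_
          rw [Fin.sum_univ_succ]
          simp [Fin.consEquiv]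
          ring

end Contraction

/-! ### McDiarmid's inequality through sub-Gaussian moment generating functions. -/

section BoundedDifferences

open ProbabilityTheory

variable {Z : Type*} [MeasurableSpace Z] (μ : Measure Z) [IsProbabilityMeasure μ]

lemma measurePreserving_cons (m : ℕ) :
    MeasurePreserving (fun p : (Fin m → Z) × Z => (Fin.cons p.2 p.1 : Fin (m + 1) → Z))
      ((Measure.pi fun _ : Fin m => μ).prod μ) (Measure.pi fun _ : Fin (m + 1) => μ) := by
  have h := ((measurePreserving_piFinSuccAbove (fun _ : Fin (m + 1) => μ) 0).symm).comp
    (Measure.measurePreserving_swap (μ := Measure.pi fun _ : Fin m => μ) (ν := μ))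
  convert! h using 1
  funext p
  exact (Fin.insertNth_zero' p.2 p.1).symm

lemma integral_pi_succ {m : ℕ} {f : (Fin (m + 1) → Z) → ℝ}
    (hf : Integrable f (Measure.pi fun _ => μ)) :
    ∫ S, f S ∂(Measure.pi fun _ => μ) =
      ∫ r, ∫ z, f (Fin.cons z r) ∂μ ∂(Measure.pi fun _ : Fin m => μ) := by
  have h := measurePreserving_cons μ m
  rw [← h.map_eq, integral_map h.aemeasurable (by rw [h.map_eq]; exact hf.1)]
  exact integral_prod _ (h.integrable_comp_of_integrable hf)

/-- Hoeffding's lemma: all values lie in the interval of length `c` starting at `⨅ z, f z`. -/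
lemma hasSubgaussianMGF_section {f : Z → ℝ} (hf : AEMeasurable f μ) {c : NNReal}
    (hc : ∀ z z', f z ≤ f z' + c) (h0 : ∀ z, 0 ≤ f z) :
    HasSubgaussianMGF (fun z => f z - ∫ z, f z ∂μ) ((c / 2) ^ 2) μ := by
  have : Nonempty Z := nonempty_of_isProbabilityMeasure μ
  have hbdd : BddBelow (Set.range f) := ⟨0, by rintro _ ⟨z, rfl⟩; exact h0 z⟩
  have h := hasSubgaussianMGF_of_mem_Icc (a := ⨅ z, f z) (b := (⨅ z, f z) + c) hf
    (Filter.Eventually.of_forall fun z => ⟨ciInf_le hbdd z, by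
      have : f z - c ≤ ⨅ z, f z := le_ciInf fun z' => by linarith [hc z z']
      linarith⟩)
  simpa using h

/-- The bounded differences inequality, in the form of a sub-Gaussian bound on the moment
generating function. -/
theorem hasSubgaussianMGF_of_bounded_differences {m : ℕ} {G : (Fin m → Z) → ℝ}
    (hG : AEMeasurable G (Measure.pi fun _ => μ)) {B : ℝ} (h0 : ∀ S, 0 ≤ G S) (hB : ∀ S, G S ≤ B)
    {c : NNReal} (hc : ∀ S i z, G (Function.update S i z) ≤ G S + c) :
    HasSubgaussianMGF (fun S => G S - ∫ S, G S ∂(Measure.pi fun _ => μ)) (m * (c / 2) ^ 2)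
      (Measure.pi fun _ => μ) := by
  induction m with
  | zero =>
    have h : ∀ S, G S - ∫ S, G S ∂(Measure.pi fun _ : Fin 0 => μ) = 0 := by
      intro S
      have : ∀ S', G S' = G S := fun S' => by rw [Subsingleton.elim S' S]
      simp [this]
    simp only [h, Nat.cast_zero, zero_mul]
    exact HasSubgaussianMGF.fun_zero
  | succ m ih =>
    set π := Measure.pi fun _ : Fin m => μ
    set π' := Measure.pi fun _ : Fin (m + 1) => μ
    have hΦ := measurePreserving_cons μ m
    have hGΦ : AEMeasurable (fun p : (Fin m → Z) × Z => G (Fin.cons p.2 p.1)) (π.prod μ) :=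
      hG.comp_quasiMeasurePreserving hΦ.quasiMeasurePreserving
    -- The conditional mean given the other coordinates. As a lower integral it inherits the bounds
    -- and bounded differences at every `r`, although sections of `G` are measurable only for almost
    -- every `r`.
    set g : (Fin m → Z) → ℝ := fun r => (∫⁻ z, ENNReal.ofReal (G (Fin.cons z r)) ∂μ).toReal
    have hle : ∀ r, ∫⁻ z, ENNReal.ofReal (G (Fin.cons z r)) ∂μ ≤ ENNReal.ofReal B := fun r => by
      calc _ ≤ ∫⁻ _, ENNReal.ofReal B ∂μ :=
            lintegral_mono fun z => ENNReal.ofReal_le_ofReal (hB _)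
        _ = _ := by simp
    have hfin : ∀ r, ∫⁻ z, ENNReal.ofReal (G (Fin.cons z r)) ∂μ ≠ ⊤ := fun r =>
      ((hle r).trans_lt ENNReal.ofReal_lt_top).ne
    have hB0 : 0 ≤ B :=
      have : Nonempty Z := nonempty_of_isProbabilityMeasure μ
      (h0 _).trans (hB (Classical.arbitrary _))
    have hgm : AEMeasurable g π := (hGΦ.ennreal_ofReal.lintegral_prod_right').ennreal_toReal
    have hg0 : ∀ r, 0 ≤ g r := fun r => ENNReal.toReal_nonneg
    have hgB : ∀ r, g r ≤ B := fun r => ENNReal.toReal_le_of_le_ofReal hB0 (hle r)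
    have hgc : ∀ r i z, g (Function.update r i z) ≤ g r + c := by
      intro r i z
      have : ∫⁻ w, ENNReal.ofReal (G (Fin.cons w (Function.update r i z))) ∂μ ≤
          ∫⁻ w, ENNReal.ofReal (G (Fin.cons w r)) ∂μ + c := by
        calc _ ≤ ∫⁻ w, (ENNReal.ofReal (G (Fin.cons w r)) + c) ∂μ := by
              refine lintegral_mono fun w => ?_
              rw [Fin.cons_update]
              calc _ ≤ ENNReal.ofReal (G (Fin.cons w r) + c) :=
                    ENNReal.ofReal_le_ofReal (hc _ _ _)
                _ ≤ _ := by
                    refine ENNReal.ofReal_add_le.trans ?_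
                    simp
          _ = _ := by rw [lintegral_add_right _ measurable_const]; simp
      have h2 := ENNReal.toReal_mono (by simp [hfin]) this
      rwa [ENNReal.toReal_add (hfin r) (by simp), ENNReal.coe_toReal] at h2
    have hint : ∀ {k : ℕ} {F : (Fin k → Z) → ℝ} (_ : AEMeasurable F (Measure.pi fun _ => μ))
        (_ : ∀ S, 0 ≤ F S) (_ : ∀ S, F S ≤ B) (a t : ℝ),
        Integrable (fun S => Real.exp (t * (F S - a))) (Measure.pi fun _ => μ) := by
      intro k F hF h0 hB a t
      exact integrable_exp_mul_of_mem_Icc (a := -a) (b := B - a) (hF.sub_const a)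
        (Filter.Eventually.of_forall fun S => ⟨by linarith [h0 S], by linarith [hB S]⟩)
    have hsec : ∀ᵐ r ∂π, AEMeasurable (fun z => G (Fin.cons z r)) μ := by
      filter_upwards [hGΦ.aestronglyMeasurable.prodMk_left] with r hr using hr.aemeasurable
    have hgint : ∀ᵐ r ∂π, ∫ z, G (Fin.cons z r) ∂μ = g r := by
      filter_upwards [hsec] with r hr
      exact integral_eq_lintegral_of_nonneg_ae (Filter.Eventually.of_forall fun z => h0 _)
        hr.aestronglyMeasurable
    have hmean : ∫ S, G S ∂π' = ∫ r, g r ∂π := by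
      rw [integral_pi_succ μ (Integrable.of_mem_Icc 0 B hG
        (Filter.Eventually.of_forall fun S => ⟨h0 S, hB S⟩))]
      exact integral_congr_ae hgint
    refine ⟨fun t => hint hG h0 hB _ t, fun t => ?_⟩
    set a := ∫ S, G S ∂π'
    have hI := hint hG h0 hB a t
    have hmgf := (ih hgm hg0 hgB hgc).mgf_le t
    rw [mgf, ← hmean] at hmgf
    rw [mgf, integral_pi_succ μ hI]
    -- Split `G - a` as `(G - g r) + (g r - a)`: the section bound handles the first term, the
    -- induction hypothesis the second.
    calc ∫ r, ∫ z, Real.exp (t * (G (Fin.cons z r) - a)) ∂μ ∂π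
        ≤ ∫ r, Real.exp (((c / 2) ^ 2 : NNReal) * t ^ 2 / 2) * Real.exp (t * (g r - a)) ∂π := by
          refine integral_mono_ae (hΦ.integrable_comp_of_integrable hI).integral_prod_left
            ((hint hgm hg0 hgB a t).const_mul _) ?_
          filter_upwards [hsec, hgint] with r hr hgr
          have h := (hasSubgaussianMGF_section μ hr (c := c) (fun z z' => by
            have := hc (Fin.cons z' r) 0 z
            rwa [Fin.update_cons_zero] at this) (fun z => h0 _)).mgf_le t
          rw [mgf, hgr] at h
          calc ∫ z, Real.exp (t * (G (Fin.cons z r) - a)) ∂μ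
              = (∫ z, Real.exp (t * (G (Fin.cons z r) - g r)) ∂μ) * Real.exp (t * (g r - a)) := by
                rw [← integral_mul_const]
                refine integral_congr_ae (Filter.Eventually.of_forall fun z => ?_)
                simp only [← Real.exp_add]
                ring_nf
            _ ≤ _ := mul_le_mul_of_nonneg_right h (Real.exp_nonneg _)
      _ = Real.exp (((c / 2) ^ 2 : NNReal) * t ^ 2 / 2) * ∫ r, Real.exp (t * (g r - a)) ∂π :=
          integral_const_mul _ _
      _ ≤ Real.exp (((c / 2) ^ 2 : NNReal) * t ^ 2 / 2) *
            Real.exp (((m : NNReal) * (c / 2) ^ 2 : NNReal) * t ^ 2 / 2) :=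
          mul_le_mul_of_nonneg_left hmgf (Real.exp_nonneg _)
      _ = _ := by
          rw [← Real.exp_add]
          congr 1
          push_cast
          ring

/-- **McDiarmid's inequality**. -/
theorem measure_gt_le_of_bounded_differences {m : ℕ} {G : (Fin m → Z) → ℝ}
    (hG : AEMeasurable G (Measure.pi fun _ => μ)) {A B : ℝ} (hA : ∀ S, A ≤ G S)
    (hB : ∀ S, G S ≤ B) {c : NNReal} (hc : ∀ S i z, G (Function.update S i z) ≤ G S + c)
    {ε : ℝ} (hε : 0 ≤ ε) :
    (Measure.pi fun _ => μ).real {S | ∫ S, G S ∂(Measure.pi fun _ => μ) + ε ≤ G S} ≤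
      Real.exp (-2 * ε ^ 2 / (m * c ^ 2)) := by
  have hint : Integrable G (Measure.pi fun _ => μ) :=
    Integrable.of_mem_Icc A B hG (Filter.Eventually.of_forall fun S => ⟨hA S, hB S⟩)
  have h := (hasSubgaussianMGF_of_bounded_differences μ (G := fun S => G S - A) (B := B - A)
    (hG.sub_const A) (fun S => by linarith [hA S]) (fun S => by linarith [hB S]) (c := c)
    (fun S i z => by linarith [hc S i z])).measure_ge_le hε
  have hA : ∫ S, (G S - A) ∂(Measure.pi fun _ => μ) = ∫ S, G S ∂(Measure.pi fun _ => μ) - A := by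
    rw [integral_sub hint (integrable_const _)]
    simp
  rw [hA] at h
  convert h using 2
  · ext S
    simp only [Set.mem_ofPred_eq]
    constructor <;> intro h <;> linarith
  · push_cast
    field_simp

end BoundedDifferences

/-! ### Symmetrization by a ghost sample. -/

section Symmetrization

variable {Z H : Type*} [MeasurableSpace Z] {D : Measure Z} [IsProbabilityMeasure D] {m : ℕ}

/-- Exchange the `i`-th coordinates of two samples whenever the `i`-th sign is `1`. -/
def exchange (σ : Fin m → ℤˣ) (p : (Fin m → Z) × (Fin m → Z)) : (Fin m → Z) × (Fin m → Z) :=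
  (fun i => if σ i = 1 then p.2 i else p.1 i, fun i => if σ i = 1 then p.1 i else p.2 i)

lemma measurePreserving_exchange (σ : Fin m → ℤˣ) :
    MeasurePreserving (exchange (Z := Z) σ)
      ((Measure.pi fun _ => D).prod (Measure.pi fun _ => D))
      ((Measure.pi fun _ => D).prod (Measure.pi fun _ => D)) := by
  have he := measurePreserving_arrowProdEquivProdArrow Z Z (Fin m) (fun _ => D) (fun _ => D)
  have hs : ∀ i, MeasurePreserving (fun p : Z × Z => if σ i = 1 then p.swap else p)
      (D.prod D) (D.prod D) := by
    intro i
    split_ifs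
    · exact Measure.measurePreserving_swap
    · exact MeasurePreserving.id _
  have hp := measurePreserving_pi (fun _ : Fin m => D.prod D) (fun _ : Fin m => D.prod D) hs
  have h := he.comp (hp.comp he.symm)
  convert! h using 1
  funext p
  refine Prod.ext (funext fun i => ?_) (funext fun i => ?_) <;>
    by_cases hi : σ i = 1 <;>
    simp [exchange, hi, MeasurableEquiv.arrowProdEquivProdArrow, Equiv.arrowProdEquivProdArrow,
      MeasurableEquiv.symm]

/-- The supremum over the class of a linear combination of the expected loss and of the losses at
the sample points. -/
noncomputable def supComb (D : Measure Z) (L : H → Z → ℝ) (c : ℝ) (a : Fin m → ℝ)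
    (S : Fin m → Z) : ℝ :=
  ⨆ h : H, (c * ∫ z, L h z ∂D + ∑ i, a i * L h (S i))

variable {L : H → Z → ℝ} {M : ℝ}

lemma MeasurableClass.aemeasurable_supComb (hL : MeasurableClass D m L) (c : ℝ) (a : Fin m → ℝ) :
    AEMeasurable (supComb D L c a) (Measure.pi fun _ => D) := hL.2 c a

lemma integral_mem_Icc (hLM : ∀ h z, L h z ∈ Set.Icc 0 M) (h : H) :
    ∫ z, L h z ∂D ∈ Set.Icc 0 M := by
  refine ⟨integral_nonneg fun z => (hLM h z).1, ?_⟩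
  have : Nonempty Z := nonempty_of_isProbabilityMeasure D
  have hM : 0 ≤ M := (hLM h (Classical.arbitrary Z)).1.trans (hLM h (Classical.arbitrary Z)).2
  calc ∫ z, L h z ∂D ≤ ∫ _, M ∂D :=
        integral_mono_of_nonneg (Filter.Eventually.of_forall fun z => (hLM h z).1)
          (integrable_const M) (Filter.Eventually.of_forall fun z => (hLM h z).2)
    _ = M := by simp

lemma abs_comb_le (hLM : ∀ h z, L h z ∈ Set.Icc 0 M) (c : ℝ) (a : Fin m → ℝ) (S : Fin m → Z)
    (h : H) : |c * ∫ z, L h z ∂D + ∑ i, a i * L h (S i)| ≤ (|c| + ∑ i, |a i|) * M := by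
  have hI := integral_mem_Icc (D := D) hLM h
  calc _ ≤ |c * ∫ z, L h z ∂D| + ∑ i, |a i * L h (S i)| :=
        (abs_add_le _ _).trans (add_le_add le_rfl (Finset.abs_sum_le_sum_abs _ _))
    _ ≤ |c| * M + ∑ i, |a i| * M := by
        refine add_le_add ?_ (Finset.sum_le_sum fun i _ => ?_)
        · rw [abs_mul, abs_of_nonneg hI.1]
          exact mul_le_mul_of_nonneg_left hI.2 (abs_nonneg _)
        · rw [abs_mul, abs_of_nonneg (hLM h _).1]
          exact mul_le_mul_of_nonneg_left (hLM h _).2 (abs_nonneg _)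
    _ = _ := by rw [add_mul, Finset.sum_mul]

lemma le_supComb (hLM : ∀ h z, L h z ∈ Set.Icc 0 M) (c : ℝ) (a : Fin m → ℝ) (S : Fin m → Z)
    (h : H) : c * ∫ z, L h z ∂D + ∑ i, a i * L h (S i) ≤ supComb D L c a S :=
  le_ciSup (f := fun h => c * ∫ z, L h z ∂D + ∑ i, a i * L h (S i))
    ⟨(|c| + ∑ i, |a i|) * M, by
      rintro _ ⟨h, rfl⟩
      exact (le_abs_self _).trans (abs_comb_le hLM c a S h)⟩ h

variable [Nonempty H]

lemma supComb_mem_Icc (hLM : ∀ h z, L h z ∈ Set.Icc 0 M) (c : ℝ) (a : Fin m → ℝ)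
    (S : Fin m → Z) :
    supComb D L c a S ∈ Set.Icc (-((|c| + ∑ i, |a i|) * M)) ((|c| + ∑ i, |a i|) * M) :=
  ⟨(abs_le.1 (abs_comb_le hLM c a S (Classical.arbitrary H))).1.trans (le_supComb hLM c a S _),
    ciSup_le fun h => (le_abs_self _).trans (abs_comb_le hLM c a S h)⟩

lemma integrable_supComb (hL : MeasurableClass D m L) (hLM : ∀ h z, L h z ∈ Set.Icc 0 M)
    (c : ℝ) (a : Fin m → ℝ) : Integrable (supComb D L c a) (Measure.pi fun _ => D) :=
  Integrable.of_mem_Icc _ _ (hL.aemeasurable_supComb c a)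
    (Filter.Eventually.of_forall fun S => supComb_mem_Icc hLM c a S)

/-- Only one summand changes, and two losses in `[0, M]` differ by at most `M`. -/
lemma supComb_update_le (hLM : ∀ h z, L h z ∈ Set.Icc 0 M) (c : ℝ) {a : Fin m → ℝ}
    (ha : ∀ i, |a i| ≤ 1) (S : Fin m → Z) (i : Fin m) (z : Z) :
    supComb D L c a (Function.update S i z) ≤ supComb D L c a S + M := by
  refine ciSup_le fun h => ?_
  have hS := le_supComb (D := D) hLM c a S h
  rw [← Finset.add_sum_erase _ _ (Finset.mem_univ i)] at hS ⊢
  have hrest : ∑ x ∈ Finset.univ.erase i, a x * L h (Function.update S i z x) =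
      ∑ x ∈ Finset.univ.erase i, a x * L h (S x) :=
    Finset.sum_congr rfl fun x hx => by rw [Function.update_of_ne (Finset.ne_of_mem_erase hx)]
  rw [hrest, Function.update_self]
  have hd : |L h z - L h (S i)| ≤ M := by
    have h1 := hLM h z
    have h2 := hLM h (S i)
    exact abs_le.2 ⟨by linarith [h1.1, h2.2], by linarith [h1.2, h2.1]⟩
  have : a i * (L h z - L h (S i)) ≤ M :=
    calc _ ≤ |a i| * |L h z - L h (S i)| := by rw [← abs_mul]; exact le_abs_self _
      _ ≤ 1 * M := mul_le_mul (ha i) hd (abs_nonneg _) zero_le_one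
      _ = M := one_mul M
  linarith

/-- The supremum over the class of the signed sum of the losses at the sample points. -/
noncomputable def supSigned (D : Measure Z) (L : H → Z → ℝ) (σ : Fin m → ℤˣ) :
    (Fin m → Z) → ℝ := supComb D L 0 fun i => signVal (σ i)

/-- The expected loss is the mean over a ghost sample `S'`. Exchanging coordinates of `S` and `S'`
according to `σ` preserves the product measure and turns each difference `L (S' i) - L (S i)` into a
signed one. -/
lemma integral_supComb_le (hL : MeasurableClass D m L) (hLM : ∀ h z, L h z ∈ Set.Icc 0 M)
    (σ : Fin m → ℤˣ) :
    ∫ S, supComb D L m (fun _ : Fin m => -1) S ∂(Measure.pi fun _ => D) ≤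
      ∫ S, supSigned D L σ S ∂(Measure.pi fun _ => D) +
        ∫ S, supSigned D L (-σ) S ∂(Measure.pi fun _ => D) := by
  set π := Measure.pi fun _ : Fin m => D
  -- The supremum is split between the two samples before integrating, so only suprema over a single
  -- sample need be measurable.
  set U : (Fin m → Z) × (Fin m → Z) → ℝ := fun p => supSigned D L σ p.1 + supSigned D L (-σ) p.2
  have hV : ∀ σ, Integrable (supSigned D L σ) π := fun σ => integrable_supComb hL hLM _ _
  have hU : Integrable U (π.prod π) := ((hV σ).comp_fst π).add ((hV (-σ)).comp_snd π)
  have hex := measurePreserving_exchange (D := D) σ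
  have hUe : Integrable (fun p => U (exchange σ p)) (π.prod π) :=
    hex.integrable_comp_of_integrable hU
  have hLint : ∀ h, Integrable (L h) D := fun h =>
    Integrable.of_mem_Icc 0 M (hL.1 h) (Filter.Eventually.of_forall fun z => hLM h z)
  have hLpi : ∀ h i, Integrable (fun S : Fin m → Z => L h (S i)) π := fun h i =>
    (measurePreserving_eval (fun _ : Fin m => D) i).integrable_comp_of_integrable (hLint h)
  have hmean : ∀ h i, ∫ S : Fin m → Z, L h (S i) ∂π = ∫ z, L h z ∂D := by
    intro h i
    have he := measurePreserving_eval (fun _ : Fin m => D) i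
    conv_rhs => rw [← he.map_eq]
    exact (integral_map he.aemeasurable (by rw [he.map_eq]; exact (hLint h).1)).symm
  have hpt : ∀ h S S', ∑ i, (L h (S' i) - L h (S i)) ≤ U (exchange σ (S, S')) := by
    intro h S S'
    have h1 := le_supComb (D := D) hLM 0 (fun i => signVal (σ i)) (exchange σ (S, S')).1 h
    have h2 := le_supComb (D := D) hLM 0 (fun i => signVal ((-σ) i)) (exchange σ (S, S')).2 h
    refine le_trans (le_of_eq ?_) (add_le_add h1 h2)
    simp only [zero_mul, zero_add]
    rw [← Finset.sum_add_distrib]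
    refine Finset.sum_congr rfl fun i _ => ?_
    rcases Int.units_eq_one_or (σ i) with hi | hi <;> simp [exchange, hi]
    · ring
    · ring
  calc ∫ S, supComb D L m (fun _ : Fin m => -1) S ∂π
      ≤ ∫ S, ∫ S', U (exchange σ (S, S')) ∂π ∂π := by
        refine integral_mono_ae (integrable_supComb hL hLM _ _) hUe.integral_prod_left ?_
        filter_upwards [hUe.prod_right_ae] with S hS
        refine ciSup_le fun h => ?_
        have hd : ∀ i, Integrable (fun S' : Fin m → Z => L h (S' i) - L h (S i)) π :=
          fun i => (hLpi h i).sub (integrable_const _)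
        calc (m : ℝ) * ∫ z, L h z ∂D + ∑ i : Fin m, -1 * L h (S i)
            = ∫ S', ∑ i, (L h (S' i) - L h (S i)) ∂π := by
              rw [integral_finsetSum _ fun i _ => hd i]
              simp_rw [integral_sub (hLpi h _) (integrable_const _), hmean]
              simp [sub_eq_add_neg, Finset.sum_add_distrib]
          _ ≤ _ := integral_mono (integrable_finsetSum _ fun i _ => hd i) hS
              fun S' => hpt h S S'
    _ = ∫ p, U (exchange σ p) ∂(π.prod π) := (integral_prod _ hUe).symm
    _ = ∫ p, U p ∂(π.prod π) := by
        conv_rhs => rw [← hex.map_eq]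
        exact (integral_map hex.aemeasurable (by rw [hex.map_eq]; exact hU.1)).symm
    _ = _ := by
        rw [integral_add ((hV σ).comp_fst π) ((hV (-σ)).comp_snd π)]
        rw [integral_fun_fst, integral_fun_snd]
        simp

/-- Symmetrization. -/
theorem integral_supComb_le_expect (hL : MeasurableClass D m L)
    (hLM : ∀ h z, L h z ∈ Set.Icc 0 M) :
    ∫ S, supComb D L m (fun _ : Fin m => -1) S ∂(Measure.pi fun _ => D) ≤
      2 * ∫ S, 𝔼 σ : Fin m → ℤˣ, supSigned D L σ S ∂(Measure.pi fun _ => D) := by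
  have hV : ∀ σ : Fin m → ℤˣ, Integrable (supSigned D L σ) (Measure.pi fun _ => D) :=
    fun σ => integrable_supComb hL hLM _ _
  have hswap : ∫ S, 𝔼 σ : Fin m → ℤˣ, supSigned D L σ S ∂(Measure.pi fun _ => D) =
      𝔼 σ : Fin m → ℤˣ, ∫ S, supSigned D L σ S ∂(Measure.pi fun _ => D) := by
    simp_rw [Fintype.expect_eq_sum_div_card]
    rw [integral_div, integral_finsetSum _ fun σ _ => hV σ]
  rw [hswap]
  calc _ = 𝔼 _σ : Fin m → ℤˣ,
        ∫ S, supComb D L m (fun _ : Fin m => -1) S ∂(Measure.pi fun _ => D) := by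
        rw [Fintype.expect_const]
    _ ≤ 𝔼 σ : Fin m → ℤˣ, (∫ S, supSigned D L σ S ∂(Measure.pi fun _ => D) +
        ∫ S, supSigned D L (-σ) S ∂(Measure.pi fun _ => D)) :=
        Finset.expect_le_expect fun σ _ => integral_supComb_le hL hLM σ
    _ = _ := by
        rw [Finset.expect_add_distrib,
          expect_neg_signs fun σ => ∫ S, supSigned D L σ S ∂(Measure.pi fun _ => D)]
        ring

end Symmetrization

/-! ### Lipschitz dependence of the margin losses on the local scores. -/

section Lipschitz

lemma abs_clip_sub_le (M a b : ℝ) : |clip M a - clip M b| ≤ |a - b| := by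
  unfold clip
  calc _ ≤ |max 0 a - max 0 b| := by
        simpa using abs_min_sub_min_le_max M (max 0 a) M (max 0 b)
    _ ≤ |a - b| := by simpa using abs_max_sub_max_le_max 0 a 0 b

lemma abs_iSup_sub_iSup_le {ι : Type*} [Finite ι] {a b : ι → ℝ} {d : ℝ} (hd : 0 ≤ d)
    (h : ∀ i, |a i - b i| ≤ d) : |(⨆ i, a i) - ⨆ i, b i| ≤ d := by
  rcases isEmpty_or_nonempty ι with _ | _
  -- With no competing output both real suprema take the default value `0`.
  · simpa using hd
  · have key : ∀ u v : ι → ℝ, (∀ i, |u i - v i| ≤ d) → ⨆ i, u i ≤ (⨆ i, v i) + d := fun u v huv =>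
      ciSup_le fun i => by
        have h1 := le_ciSup (Set.finite_range v).bddAbove i
        have h2 := (abs_le.1 (huv i)).2
        linarith
    have h1 := key a b h
    have h2 := key b a fun i => by rw [abs_sub_comm]; exact h i
    exact abs_le.2 ⟨by linarith, by linarith⟩

variable {X Y : Type*} {O : OutputModel X Y} {H : Type*} (F : ScoringFamily O H)

instance (x : X × Y) : Finite (O.out x.1) := Finite.of_injective _ (O.coords x).injective

instance (z : X × Y) : Finite {y : Y // y ∈ O.out z.1 ∧ y ≠ z.2} :=
  Finite.of_injective (fun y => (⟨y.1, y.2.1⟩ : O.out z.1)) fun a b hab => by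
    simpa [Subtype.ext_iff] using hab

/-- The distance of two local scoring vectors at an example, scaled by the square root of the number
of factors. -/
noncomputable def ScoringFamily.localDist (h h' : H) (z : X × Y) : ℝ :=
  Real.sqrt (Fintype.card (O.Factor z)) *
    Real.sqrt (∑ p : (f : O.Factor z) × O.LocalOutput z f,
      (F.localScore h z p.1 p.2 - F.localScore h' z p.1 p.2) ^ 2)

lemma ScoringFamily.localDist_nonneg (h h' : H) (z : X × Y) : 0 ≤ F.localDist h h' z := by
  unfold localDist
  positivity

/-- Cauchy–Schwarz over the factors, the source of `√|F|`; then the one squared entry selected at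
each factor is bounded by the sum over all local outputs. -/
lemma ScoringFamily.abs_score_sub_le (h h' : H) {z : X × Y} (hz : z.2 ∈ O.out z.1) {y : Y}
    (hy : y ∈ O.out z.1) : |F.score h z.1 y - F.score h' z.1 y| ≤ F.localDist h h' z := by
  rw [F.score_eq h z hz ⟨y, hy⟩, F.score_eq h' z hz ⟨y, hy⟩, ← Finset.sum_sub_distrib,
    localDist, ← Real.sqrt_mul (Nat.cast_nonneg _)]
  refine Real.abs_le_sqrt (sq_sum_le_card_mul_sum_sq.trans ?_)
  rw [Finset.card_univ, Fintype.sum_sigma]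
  refine mul_le_mul_of_nonneg_left (Finset.sum_le_sum fun f _ => ?_) (Nat.cast_nonneg _)
  exact Finset.single_le_sum (f := fun y => (F.localScore h z f y - F.localScore h' z f y) ^ 2)
    (fun _ _ => sq_nonneg _) (Finset.mem_univ (O.restrict z f ⟨y, hy⟩))

variable {loss : Y → Y → ℝ} {ρ : ℝ}

lemma ScoringFamily.abs_margin_sub_le (hρ : 0 < ρ) (h h' : H) {z : X × Y} (hz : z.2 ∈ O.out z.1)
    {y : Y} (hy : y ∈ O.out z.1) :
    |(1 / ρ) * (F.score h z.1 z.2 - F.score h z.1 y) -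
      (1 / ρ) * (F.score h' z.1 z.2 - F.score h' z.1 y)| ≤ 2 / ρ * F.localDist h h' z := by
  have h1 := F.abs_score_sub_le h h' hz hz
  have h2 := F.abs_score_sub_le h h' hz hy
  rw [← mul_sub, abs_mul, abs_of_pos (by positivity : 0 < 1 / ρ)]
  calc _ ≤ 1 / ρ * (F.localDist h h' z + F.localDist h h' z) := by
        refine mul_le_mul_of_nonneg_left ?_ (by positivity)
        calc _ = |(F.score h z.1 z.2 - F.score h' z.1 z.2) -
              (F.score h z.1 y - F.score h' z.1 y)| := by ring_nf
          _ ≤ _ := (abs_sub _ _).trans (add_le_add h1 h2)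
    _ = _ := by ring

lemma ScoringFamily.abs_addLoss_sub_le (hρ : 0 < ρ) (h h' : H) {z : X × Y}
    (hz : z.2 ∈ O.out z.1) :
    |F.addLoss loss ρ h z - F.addLoss loss ρ h' z| ≤ 2 / ρ * F.localDist h h' z := by
  have hd := F.localDist_nonneg h h' z
  refine (abs_clip_sub_le _ _ _).trans (abs_iSup_sub_iSup_le (by positivity) fun y => ?_)
  rw [sub_sub_sub_cancel_left, abs_sub_comm]
  exact F.abs_margin_sub_le hρ h h' hz y.2.1

lemma le_maxLoss (hb : BddAbove (Set.range fun p : Y × Y => loss p.1 p.2)) (y y' : Y) :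
    loss y y' ≤ maxLoss loss :=
  le_csSup hb ⟨(y, y'), rfl⟩

/-- Truncation and maximum are 1-Lipschitz; here the margin carries a weight `loss y z.2 ≤ M`. -/
lemma ScoringFamily.abs_multLoss_sub_le (loss_nonneg : ∀ y y', 0 ≤ loss y y')
    (hb : BddAbove (Set.range fun p : Y × Y => loss p.1 p.2)) (hρ : 0 < ρ) (h h' : H)
    {z : X × Y} (hz : z.2 ∈ O.out z.1) :
    |F.multLoss loss ρ h z - F.multLoss loss ρ h' z| ≤
      2 * maxLoss loss / ρ * F.localDist h h' z := by
  have hM : 0 ≤ maxLoss loss := (loss_nonneg z.2 z.2).trans (le_maxLoss hb _ _)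
  have hd := F.localDist_nonneg h h' z
  refine (abs_clip_sub_le _ _ _).trans (abs_iSup_sub_iSup_le (by positivity) fun y => ?_)
  rw [← mul_sub, sub_sub_sub_cancel_left, abs_mul, abs_of_nonneg (loss_nonneg _ _), abs_sub_comm]
  calc _ ≤ maxLoss loss * (2 / ρ * F.localDist h h' z) :=
        mul_le_mul (le_maxLoss hb _ _) (F.abs_margin_sub_le hρ h h' hz y.2.1) (abs_nonneg _) hM
    _ = _ := by ring

end Lipschitz

/-! ### From signed losses to the empirical factor graph complexity. -/

section Bridge

variable {X Y : Type*} {O : OutputModel X Y} {H : Type*} (F : ScoringFamily O H)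

open Classical in
/-- The expectation over the signs of the local scores, as an iterated average. -/
lemma expect_curry {m : ℕ} {S : Fin m → X × Y} (f : (O.SignIndex S → ℤˣ) → ℝ) :
    𝔼 ε : (i : Fin m) → ((f : O.Factor (S i)) × O.LocalOutput (S i) f) → ℤˣ,
      f (fun p => ε p.1 p.2) = 𝔼 ε, f ε :=
  Fintype.expect_equiv (Equiv.piCurry fun (i : Fin m)
    (_ : (f : O.Factor (S i)) × O.LocalOutput (S i) f) => ℤˣ).symm _ _ fun _ => rfl

lemma ScoringFamily.signedSum_eq {m : ℕ} (S : Fin m → X × Y) (ε : O.SignIndex S → ℤˣ) (h : H) :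
    F.signedSum S ε h = ∑ i, radSum (fun p : (f : O.Factor (S i)) × O.LocalOutput (S i) f =>
      Real.sqrt (Fintype.card (O.Factor (S i))) * F.localScore h (S i) p.1 p.2)
        (fun p => ε ⟨i, p⟩) := by
  unfold signedSum radSum
  refine Finset.sum_congr rfl fun i _ => ?_
  rw [Fintype.sum_sigma]
  refine Finset.sum_congr rfl fun f _ => Finset.sum_congr rfl fun y _ => ?_
  rw [signVal]
  ring

variable [Nonempty H] {L : H → X × Y → ℝ} {K : ℝ}

open Classical in
/-- Contraction from losses to local scores, for a class of bounded signed sums. -/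
lemma ScoringFamily.expect_iSup_le {m : ℕ} {S : Fin m → X × Y} (hK : 0 < K)
    (hL : ∀ i h h', |L h (S i) - L h' (S i)| ≤ K * F.localDist h h' (S i))
    (hbdd : ∀ ε : O.SignIndex S → ℤˣ, BddAbove (Set.range (F.signedSum S ε))) :
    𝔼 σ : Fin m → ℤˣ, ⨆ h, ∑ i, signVal (σ i) * L h (S i) ≤
      Real.sqrt 2 * K * 𝔼 ε : O.SignIndex S → ℤˣ, ⨆ h, F.signedSum S ε h := by
  refine le_of_forall_pos_le_add fun η hη => ?_
  -- Reduction to a finite class: one `η`-maximizer per sign pattern suffices, so the contraction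
  -- inequality is applied with the patterns as index set.
  have hnear : ∀ σ : Fin m → ℤˣ, ∃ h₀ : H,
      (⨆ h, ∑ i, signVal (σ i) * L h (S i)) - η < ∑ i, signVal (σ i) * L h₀ (S i) := fun σ =>
    exists_lt_of_lt_ciSup (sub_lt_self _ hη)
  choose t ht using hnear
  set v : (i : Fin m) → (Fin m → ℤˣ) → ((f : O.Factor (S i)) × O.LocalOutput (S i) f) → ℝ :=
    fun i τ p => K * (Real.sqrt (Fintype.card (O.Factor (S i))) *
      F.localScore (t τ) (S i) p.1 p.2)
  have hcontr := expect_iSup_le_of_lipschitz m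
    (fun i => (f : O.Factor (S i)) × O.LocalOutput (S i) f) (fun i τ => L (t τ) (S i)) v
    (fun i τ τ' => by
      refine (hL i (t τ) (t τ')).trans (le_of_eq ?_)
      simp only [v, ← mul_sub, mul_pow, ← Finset.mul_sum, localDist]
      rw [Real.sqrt_mul (by positivity), Real.sqrt_mul (by positivity), Real.sqrt_sq hK.le,
        Real.sqrt_sq (Real.sqrt_nonneg _)])
    (fun _ => 0)
  have hv : ∀ (ε : O.SignIndex S → ℤˣ) τ,
      ∑ i, radSum (v i τ) (fun p => ε ⟨i, p⟩) = K * F.signedSum S ε (t τ) := by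
    intro ε τ
    rw [signedSum_eq, Finset.mul_sum]
    refine Finset.sum_congr rfl fun i _ => ?_
    simp only [radSum, Finset.mul_sum, v]
    exact Finset.sum_congr rfl fun p _ => by ring
  simp only [add_zero] at hcontr
  calc 𝔼 σ : Fin m → ℤˣ, ⨆ h, ∑ i, signVal (σ i) * L h (S i)
      ≤ 𝔼 σ : Fin m → ℤˣ, ((⨆ τ, ∑ i, signVal (σ i) * L (t τ) (S i)) + η) := by
        refine Finset.expect_le_expect fun σ _ => ?_
        have := le_ciSup (f := fun τ => ∑ i, signVal (σ i) * L (t τ) (S i))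
          (Set.finite_range _).bddAbove σ
        linarith [ht σ]
    _ = 𝔼 σ : Fin m → ℤˣ, (⨆ τ, ∑ i, signVal (σ i) * L (t τ) (S i)) + η := by
        rw [Finset.expect_add_distrib, Fintype.expect_const]
    _ ≤ Real.sqrt 2 * K * 𝔼 ε : O.SignIndex S → ℤˣ, (⨆ h, F.signedSum S ε h) + η := by
        refine add_le_add (hcontr.trans ?_) le_rfl
        rw [← expect_curry, Finset.mul_expect]
        refine Finset.expect_le_expect fun ε _ => ciSup_le fun τ => ?_
        rw [mul_assoc, hv (fun p => ε p.1 p.2)]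
        exact mul_le_mul_of_nonneg_left (mul_le_mul_of_nonneg_left (le_ciSup (hbdd _) _) hK.le)
          (Real.sqrt_nonneg _)

/-- The real supremum of an unbounded family is a default value, so the two notions of supremum can
be compared only in the bounded case. -/
lemma iSup_coe_eq_top_or_bddAbove (f : H → ℝ) :
    (⨆ h, (f h : EReal)) = ⊤ ∨
      BddAbove (Set.range f) ∧ (⨆ h, (f h : EReal)) = ((⨆ h, f h : ℝ) : EReal) := by
  by_cases hf : BddAbove (Set.range f)
  · refine Or.inr ⟨hf, le_antisymm (iSup_le fun h => by exact_mod_cast le_ciSup hf h) ?_⟩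
    refine EReal.le_of_forall_lt_iff_le.1 fun b hb => ?_
    exact_mod_cast ciSup_le fun h => by
      have := (le_iSup (fun h => (f h : EReal)) h).trans hb.le
      exact_mod_cast this
  · refine Or.inl (EReal.eq_top_iff_forall_lt _ |>.2 fun b => ?_)
    rw [not_bddAbove_iff] at hf
    obtain ⟨_, ⟨h, rfl⟩, hb⟩ := hf b
    exact lt_of_lt_of_le (by exact_mod_cast hb) (le_iSup (fun h => (f h : EReal)) h)

lemma ereal_coe_sum {ι : Type*} (s : Finset ι) (f : ι → ℝ) :
    ((∑ i ∈ s, f i : ℝ) : EReal) = ∑ i ∈ s, (f i : EReal) := by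
  classical
  induction s using Finset.induction_on with
  | empty => simp
  | insert a s ha ih => rw [Finset.sum_insert ha, Finset.sum_insert ha, EReal.coe_add, ih]

/-- Contraction from losses to the empirical factor graph Rademacher complexity. -/
theorem ScoringFamily.expect_iSup_le_empRademacher {m : ℕ} (hm : 0 < m) {S : Fin m → X × Y}
    (hK : 0 < K) (hL : ∀ i h h', |L h (S i) - L h' (S i)| ≤ K * F.localDist h h' (S i)) :
    ((𝔼 σ : Fin m → ℤˣ, ⨆ h, ∑ i, signVal (σ i) * L h (S i) : ℝ) : EReal) ≤
      ((m * (Real.sqrt 2 * K) : ℝ) : EReal) * F.empRademacher S := by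
  classical
  have hm' : (0 : ℝ) < m := by exact_mod_cast hm
  have hc : (0 : ℝ) < (m : ℝ)⁻¹ * ((Fintype.card (O.SignIndex S → ℤˣ) : ℝ))⁻¹ := by
    have : 0 < Fintype.card (O.SignIndex S → ℤˣ) := Fintype.card_pos
    positivity
  have hdich := fun ε => iSup_coe_eq_top_or_bddAbove (F.signedSum S ε)
  by_cases htop : ∃ ε, (⨆ h, (F.signedSum S ε h : EReal)) = ⊤
  -- One infinite supremum makes the whole sum infinite: as `H` is nonempty, no other term is `⊥`.
  · obtain ⟨ε, hε⟩ := htop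
    have hsum : ∑ ε : O.SignIndex S → ℤˣ, ⨆ h : H, ((F.signedSum S ε h : ℝ) : EReal) = ⊤ := by
      rw [← Finset.add_sum_erase _ _ (Finset.mem_univ ε), hε]
      refine EReal.top_add_of_ne_bot ?_
      refine Finset.sum_induction _ (· ≠ ⊥) (fun a b ha hb => ?_) (by simp) fun ε' _ => ?_
      · simp [EReal.add_eq_bot_iff, ha, hb]
      · rcases hdich ε' with h | h
        · simp [h]
        · simp [h.2]
    have : F.empRademacher S = ⊤ := by
      unfold empRademacher
      convert EReal.coe_mul_top_of_pos hc
    rw [this, EReal.coe_mul_top_of_pos (by positivity)]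
    exact le_top
  · have hb := fun ε => (hdich ε).resolve_left fun h => htop ⟨ε, h⟩
    have : F.empRademacher S =
        (((m : ℝ)⁻¹ * 𝔼 ε : O.SignIndex S → ℤˣ, ⨆ h, F.signedSum S ε h : ℝ) : EReal) := by
      unfold empRademacher
      simp_rw [fun ε => (hb ε).2]
      rw [← ereal_coe_sum, ← EReal.coe_mul, Fintype.expect_eq_sum_div_card]
      congr 1
      rw [div_eq_inv_mul, mul_assoc]
    rw [this, ← EReal.coe_mul]
    refine EReal.coe_le_coe_iff.2 ((F.expect_iSup_le hK hL fun ε => (hb ε).1).trans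
      (le_of_eq ?_))
    field_simp

end Bridge

/-! ### The uniform bound for a Lipschitz class, and the margin losses as majorants. -/

section Bounds

variable {X Y H : Type*} [MeasurableSpace X] [MeasurableSpace Y] [Nonempty H]
  {O : OutputModel X Y} (F : ScoringFamily O H) {D : Measure (X × Y)} [IsProbabilityMeasure D]
  {m : ℕ} {L : H → X × Y → ℝ} {M K : ℝ}

lemma ae_forall_eval {Z : Type*} [MeasurableSpace Z] {D : Measure Z} [IsProbabilityMeasure D]
    {p : Z → Prop} (hp : ∀ᵐ z ∂D, p z) :
    ∀ᵐ S : Fin m → Z ∂(Measure.pi fun _ => D), ∀ i, p (S i) :=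
  ae_all_iff.2 fun i =>
    (Measure.quasiMeasurePreserving_eval (fun _ : Fin m => D) i).ae hp

/-- The expected Rademacher average of a class of losses is controlled by the factor graph Rademacher
complexity. -/
lemma ScoringFamily.integral_expect_supSigned_le (hm : 0 < m) (hL : MeasurableClass D m L)
    (hLM : ∀ h z, L h z ∈ Set.Icc 0 M) (hK : 0 < K)
    (hlip : ∀ᵐ z ∂D, ∀ h h', |L h z - L h' z| ≤ K * F.localDist h h' z)
    (hR : F.rademacher D m ≠ ⊤) :
    ∫ S, 𝔼 σ : Fin m → ℤˣ, supSigned D L σ S ∂(Measure.pi fun _ => D) ≤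
      m * (Real.sqrt 2 * K) * (F.rademacher D m).toReal := by
  set k : ℝ := m * (Real.sqrt 2 * K)
  have hk : 0 ≤ k := by positivity
  have hint : Integrable (fun S => 𝔼 σ : Fin m → ℤˣ, supSigned D L σ S)
      (Measure.pi fun _ => D) := by
    simp_rw [Fintype.expect_eq_sum_div_card]
    exact (integrable_finsetSum _ fun σ _ => integrable_supComb hL hLM _ _).div_const _
  -- The negative part is discarded, so the comparison takes place between lower integrals, where
  -- the empirical complexity may be infinite.
  rw [integral_eq_lintegral_pos_part_sub_lintegral_neg_part hint]
  refine (sub_le_self _ ENNReal.toReal_nonneg).trans ?_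
  have hle : ∫⁻ S, ENNReal.ofReal (𝔼 σ : Fin m → ℤˣ, supSigned D L σ S)
      ∂(Measure.pi fun _ => D) ≤ ENNReal.ofReal k * F.rademacher D m := by
    rw [rademacher, ← lintegral_const_mul' _ _ ENNReal.ofReal_ne_top]
    refine lintegral_mono_ae ?_
    filter_upwards [ae_forall_eval (m := m) hlip] with S hS
    have h := EReal.toENNReal_le_toENNReal (F.expect_iSup_le_empRademacher hm hK hS)
    rw [EReal.toENNReal_mul (by exact_mod_cast hk), EReal.real_coe_toENNReal,
      EReal.real_coe_toENNReal] at h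
    simpa only [supSigned, supComb, zero_mul, zero_add] using h
  have h2 := ENNReal.toReal_mono (ENNReal.mul_ne_top ENNReal.ofReal_ne_top hR) hle
  rwa [ENNReal.toReal_mul, ENNReal.toReal_ofReal hk] at h2

/-- Subadditivity is enough, so neither event has to be measurable. -/
lemma one_sub_le_measure_of_compl {Ω : Type*} [MeasurableSpace Ω] {μ : Measure Ω}
    [IsProbabilityMeasure μ] {s t : Set Ω} {δ : ℝ} (ht : μ.real t ≤ δ) (hst : tᶜ ⊆ s) :
    ENNReal.ofReal (1 - δ) ≤ μ s := by
  have h1 : 1 ≤ μ s + μ t := by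
    rw [← measure_univ (μ := μ)]
    exact (measure_mono fun x _ => by
      by_cases hx : x ∈ t
      · exact Or.inr hx
      · exact Or.inl (hst hx)).trans (measure_union_le s t)
  have h2 : μ t ≤ ENNReal.ofReal δ := by
    rw [← ENNReal.ofReal_toReal (measure_ne_top μ t)]
    exact ENNReal.ofReal_le_ofReal ht
  have hδ : 0 ≤ δ := measureReal_nonneg.trans ht
  rw [ENNReal.ofReal_sub _ hδ, ENNReal.ofReal_one]
  exact tsub_le_iff_right.2 (h1.trans (add_le_add le_rfl h2))

/-- The generalization bound for a class of bounded losses which are Lipschitz in the local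
scores. -/
theorem ScoringFamily.generalization_bound (hm : 0 < m) (hL : MeasurableClass D m L)
    (hM : 0 ≤ M) (hLM : ∀ h z, L h z ∈ Set.Icc 0 M) (hK : 0 ≤ K) (hMK : 0 < M → 0 < K)
    (hlip : ∀ᵐ z ∂D, ∀ h h', |L h z - L h' z| ≤ K * F.localDist h h' z)
    {δ : ℝ} (hδ : 0 < δ) :
    ENNReal.ofReal (1 - δ) ≤ (Measure.pi fun _ : Fin m => D)
      {S | ∀ h : H, ((∫ z, L h z ∂D : ℝ) : EReal) ≤ ((empMean S (L h) : ℝ) : EReal)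
        + ((2 * Real.sqrt 2 * K : ℝ) : EReal) * (F.rademacher D m : EReal)
        + ((M * Real.sqrt (Real.log (1 / δ) / (2 * m)) : ℝ) : EReal)} := by
  have hm' : (0 : ℝ) < m := by exact_mod_cast hm
  -- If `M = 0` all losses vanish. This case is apart because `K` may then be `0`, while contraction
  -- needs `K > 0`.
  obtain rfl | hM := hM.eq_or_lt
  · refine one_sub_le_measure_of_compl (t := ∅) (by simpa using hδ.le) fun S _ h => ?_
    have h0 : ∀ z, L h z = 0 := fun z => le_antisymm (hLM h z).2 (hLM h z).1
    have hC : (0 : EReal) ≤ ((2 * Real.sqrt 2 * K : ℝ) : EReal) := by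
      have : 0 ≤ 2 * Real.sqrt 2 * K := by positivity
      exact_mod_cast this
    simpa [empMean, h0] using mul_nonneg hC (EReal.coe_ennreal_nonneg (F.rademacher D m))
  replace hK := hMK hM
  rcases le_or_gt 1 δ with hδ1 | hδ1
  · rw [ENNReal.ofReal_of_nonpos (by linarith)]
    exact zero_le
  by_cases hR : F.rademacher D m = ⊤
  · have hpos : 0 < 2 * Real.sqrt 2 * K := by positivity
    refine one_sub_le_measure_of_compl (t := ∅) (by simpa using hδ.le) fun S _ h => ?_
    rw [hR, EReal.coe_ennreal_top, EReal.coe_mul_top_of_pos hpos, EReal.coe_add_top,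
      EReal.top_add_coe]
    exact le_top
  set r := (F.rademacher D m).toReal
  have hr : (F.rademacher D m : EReal) = ((r : ℝ) : EReal) := by
    conv_lhs => rw [← ENNReal.ofReal_toReal hR]
    rw [EReal.coe_ennreal_ofReal, max_eq_left ENNReal.toReal_nonneg]
  set s := Real.sqrt (Real.log (1 / δ) / (2 * m))
  have hlog : 0 ≤ Real.log (1 / δ) := Real.log_nonneg (by rw [le_div_iff₀ hδ]; linarith)
  have hs : s ^ 2 = Real.log (1 / δ) / (2 * m) := Real.sq_sqrt (by positivity)
  -- This is `m` times the worst gap between expected and empirical loss, whence differences `M` and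
  -- deviation `m * M * s`.
  set G := supComb D L (m : ℝ) (fun _ : Fin m => -1)
  have hG := measure_gt_le_of_bounded_differences D (G := G) (hL.aemeasurable_supComb _ _)
    (fun S => (supComb_mem_Icc hLM _ _ S).1) (fun S => (supComb_mem_Icc hLM _ _ S).2)
    (c := M.toNNReal) (fun S i z => by
      rw [Real.coe_toNNReal _ hM.le]
      exact supComb_update_le hLM _ (by simp) S i z)
    (ε := m * M * s) (by positivity)
  have hexp : Real.exp (-2 * (m * M * s) ^ 2 / (m * (M.toNNReal : ℝ) ^ 2)) = δ := by
    rw [Real.coe_toNNReal _ hM.le, mul_pow, hs]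
    have : -2 * ((m * M) ^ 2 * (Real.log (1 / δ) / (2 * m))) / (m * M ^ 2) = Real.log δ := by
      rw [one_div, Real.log_inv]
      field_simp
    rw [this, Real.exp_log hδ]
  refine one_sub_le_measure_of_compl (hG.trans hexp.le) fun S hS h => ?_
  rw [hr, ← EReal.coe_mul, ← EReal.coe_add, ← EReal.coe_add, EReal.coe_le_coe_iff]
  have h1 : G S < ∫ S, G S ∂(Measure.pi fun _ => D) + m * M * s := not_le.1 hS
  have h2 := le_supComb (D := D) hLM (m : ℝ) (fun _ => -1) S h
  have h3 := integral_supComb_le_expect hL hLM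
  have h4 := F.integral_expect_supSigned_le hm hL hLM hK hlip hR
  have h5 : (m : ℝ) * ∫ z, L h z ∂D ≤ m * (empMean S (L h) + 2 * Real.sqrt 2 * K * r + M * s) := by
    have : (m : ℝ) * empMean S (L h) = ∑ i, L h (S i) := by
      rw [empMean]
      field_simp
    rw [mul_add, mul_add, this]
    simp only [neg_one_mul, Finset.sum_neg_distrib] at h2
    linarith
  exact le_of_mul_le_mul_left h5 hm'

lemma clip_mem_Icc {M : ℝ} (hM : 0 ≤ M) (r : ℝ) : clip M r ∈ Set.Icc 0 M :=
  ⟨le_min hM (le_max_left _ _), min_le_left _ _⟩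

variable {loss : Y → Y → ℝ} {ρ : ℝ} {pred : H → X → Y}

/-- A correct prediction has zero loss; a wrong one is itself among the competitors in the supremum.
-/
lemma ScoringFamily.loss_pred_le_clip {c : Y → ℝ} {z : X × Y} {h : H}
    (loss_definite : ∀ y y', loss y y' = 0 ↔ y = y')
    (hb : BddAbove (Set.range fun p : Y × Y => loss p.1 p.2)) (hM : 0 ≤ maxLoss loss)
    (hpred : F.IsPredictor pred) (hc : loss (pred h z.1) z.2 ≤ c (pred h z.1)) :
    loss (pred h z.1) z.2 ≤
      clip (maxLoss loss) (⨆ y : {y : Y // y ∈ O.out z.1 ∧ y ≠ z.2}, c y) := by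
  by_cases hp : pred h z.1 = z.2
  · rw [(loss_definite _ _).2 hp]
    exact (clip_mem_Icc hM _).1
  · refine le_min (le_maxLoss hb _ _) (le_max_of_le_right (hc.trans ?_))
    exact le_ciSup (f := fun y : {y : Y // y ∈ O.out z.1 ∧ y ≠ z.2} => c y)
      (Set.finite_range _).bddAbove ⟨pred h z.1, (hpred h z.1).1, hp⟩

lemma ScoringFamily.margin_pred_nonpos (hpred : F.IsPredictor pred) (hρ : 0 < ρ) (h : H)
    {z : X × Y} (hz : z.2 ∈ O.out z.1) :
    (1 / ρ) * (F.score h z.1 z.2 - F.score h z.1 (pred h z.1)) ≤ 0 :=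
  mul_nonpos_of_nonneg_of_nonpos (by positivity) (sub_nonpos.2 ((hpred h z.1).2 _ hz))

lemma integral_loss_le {D : Measure (X × Y)} [IsProbabilityMeasure D] {f g : X × Y → ℝ} {M : ℝ}
    (hf : AEMeasurable f D) (hg : AEMeasurable g D) (hfM : ∀ z, f z ∈ Set.Icc 0 M)
    (hgM : ∀ z, g z ∈ Set.Icc 0 M) (hfg : f ≤ᵐ[D] g) : ∫ z, f z ∂D ≤ ∫ z, g z ∂D :=
  integral_mono_ae (Integrable.of_mem_Icc 0 M hf (Filter.Eventually.of_forall hfM))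
    (Integrable.of_mem_Icc 0 M hg (Filter.Eventually.of_forall hgM)) hfg

end Bounds

end StructPred

/-! ### The additive and multiplicative margin bounds. -/

theorem theorem1 {X Y H : Type*} [MeasurableSpace X] [MeasurableSpace Y] [Nonempty H]
    (O : StructPred.OutputModel X Y) (F : StructPred.ScoringFamily O H)
    (loss : Y → Y → ℝ) (loss_nonneg : ∀ y y', 0 ≤ loss y y')
    (loss_definite : ∀ y y', loss y y' = 0 ↔ y = y')
    (loss_bounded : BddAbove (Set.range fun p : Y × Y => loss p.1 p.2))
    (D : MeasureTheory.Measure (X × Y)) [MeasureTheory.IsProbabilityMeasure D]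
    (hD : ∀ᵐ z ∂D, z.2 ∈ O.out z.1)
    (pred : H → X → Y) (hpred : F.IsPredictor pred)
    (ρ : ℝ) (hρ : 0 < ρ) (m : ℕ) (hm : 0 < m)
    (meas_pred : ∀ h, AEMeasurable (fun z : X × Y => loss (pred h z.1) z.2) D)
    (meas_add : StructPred.MeasurableClass D m (F.addLoss loss ρ))
    (meas_mult : StructPred.MeasurableClass D m (F.multLoss loss ρ))
    (meas_rademacher : AEMeasurable (fun S : Fin m → X × Y => F.empRademacher S)
      (MeasureTheory.Measure.pi fun _ => D))
    (δ : ℝ) (hδ : 0 < δ) :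
    ENNReal.ofReal (1 - δ) ≤ (MeasureTheory.Measure.pi fun _ : Fin m => D)
      {S | ∀ h : H,
        ∫ z, loss (pred h z.1) z.2 ∂D ≤ ∫ z, F.addLoss loss ρ h z ∂D ∧
        ((∫ z, F.addLoss loss ρ h z ∂D : ℝ) : EReal) ≤
          ((StructPred.empMean S (F.addLoss loss ρ h) : ℝ) : EReal)
            + ((4 * Real.sqrt 2 / ρ : ℝ) : EReal) * (F.rademacher D m : EReal)
            + ((StructPred.maxLoss loss * Real.sqrt (Real.log (1 / δ) / (2 * m)) : ℝ) : EReal)} ∧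
    ENNReal.ofReal (1 - δ) ≤ (MeasureTheory.Measure.pi fun _ : Fin m => D)
      {S | ∀ h : H,
        ∫ z, loss (pred h z.1) z.2 ∂D ≤ ∫ z, F.multLoss loss ρ h z ∂D ∧
        ((∫ z, F.multLoss loss ρ h z ∂D : ℝ) : EReal) ≤
          ((StructPred.empMean S (F.multLoss loss ρ h) : ℝ) : EReal)
            + ((4 * Real.sqrt 2 * StructPred.maxLoss loss / ρ : ℝ) : EReal)
              * (F.rademacher D m : EReal)
            + ((StructPred.maxLoss loss * Real.sqrt (Real.log (1 / δ) / (2 * m)) : ℝ) : EReal)} := by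
  obtain ⟨z₀⟩ := nonempty_of_isProbabilityMeasure D
  set M := StructPred.maxLoss loss
  have hloss : ∀ y y', loss y y' ∈ Set.Icc 0 M := fun y y' =>
    ⟨loss_nonneg y y', StructPred.le_maxLoss loss_bounded y y'⟩
  have hM : 0 ≤ M := (hloss z₀.2 z₀.2).1.trans (hloss z₀.2 z₀.2).2
  have hadd : ∀ h z, F.addLoss loss ρ h z ∈ Set.Icc 0 M := fun h z =>
    StructPred.clip_mem_Icc hM _
  have hmult : ∀ h z, F.multLoss loss ρ h z ∈ Set.Icc 0 M := fun h z =>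
    StructPred.clip_mem_Icc hM _
  have hRadd : ∀ h, ∫ z, loss (pred h z.1) z.2 ∂D ≤ ∫ z, F.addLoss loss ρ h z ∂D := fun h =>
    StructPred.integral_loss_le (meas_pred h) (meas_add.1 h) (fun z => hloss _ _) (hadd h) <| by
      filter_upwards [hD] with z hz
      refine F.loss_pred_le_clip
        (c := fun y => loss y z.2 - (1 / ρ) * (F.score h z.1 z.2 - F.score h z.1 y))
        loss_definite loss_bounded hM hpred ?_
      linarith [F.margin_pred_nonpos hpred hρ h hz]
  have hRmult : ∀ h, ∫ z, loss (pred h z.1) z.2 ∂D ≤ ∫ z, F.multLoss loss ρ h z ∂D := fun h =>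
    StructPred.integral_loss_le (meas_pred h) (meas_mult.1 h) (fun z => hloss _ _) (hmult h) <| by
      filter_upwards [hD] with z hz
      refine F.loss_pred_le_clip
        (c := fun y => loss y z.2 * (1 - (1 / ρ) * (F.score h z.1 z.2 - F.score h z.1 y)))
        loss_definite loss_bounded hM hpred ?_
      refine le_mul_of_one_le_right (loss_nonneg _ _) ?_
      linarith [F.margin_pred_nonpos hpred hρ h hz]
  constructor
  · have hb := F.generalization_bound hm meas_add hM hadd (K := 2 / ρ) (by positivity)
      (fun _ => by positivity)
      (by filter_upwards [hD] with z hz h h' using F.abs_addLoss_sub_le hρ h h' hz) hδ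
    rw [show 2 * Real.sqrt 2 * (2 / ρ) = 4 * Real.sqrt 2 / ρ by ring] at hb
    exact hb.trans (MeasureTheory.measure_mono fun S hS h => ⟨hRadd h, hS h⟩)
  · have hb := F.generalization_bound hm meas_mult hM hmult (K := 2 * M / ρ) (by positivity)
      -- Here `K = 2 * M / ρ` is positive only when `M` is.
      (fun _ => by positivity)
      (by
        filter_upwards [hD] with z hz h h'
          using F.abs_multLoss_sub_le loss_nonneg loss_bounded hρ h h' hz) hδ
    rw [show 2 * Real.sqrt 2 * (2 * M / ρ) = 4 * Real.sqrt 2 * M / ρ by ring] at hb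
    exact hb.trans (MeasureTheory.measure_mono fun S hS h => ⟨hRmult h, hS h⟩)
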